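/- Let $(\lambda_k)_{k\ge 1}$ be a nondecreasing sequence of positive real numbers tending to infinity, with $\lambda_1=1$ and $\lambda_{k+1}\le\lambda_k+1$ for all $k$, and let $I_k$ be the set of integers in $[k-\lambda_k+1,\,k]$. For $1<p<\infty$ let $V_p(\lambda)$ be the space of all real sequences $x=(x_j)_{j\ge 1}$ with $$\|x\|=\left(\sum_{k=1}^{\infty}\Big(\frac1{\lambda_k}\sum_{j\in I_k}|x_j|\Big)^{p}\right)^{1/p}<\infty,$$ equipped with this norm. A Banach space $X$ with closed unit ball $B(X)$ is called nearly uniformly convex (NUC) if for every $\varepsilon>0$ there is $\delta\in(0,1)$ such that for every sequence $(x_n)$ in $B(X)$ with $\inf_{n\ne m}\|x_n-x_m\|>\varepsilon$ one has $\operatorname{conv}\{x_n\}\cap(1-\delta)B(X)\neq\varnothing$. Then for every such sequence $\lambda$ and every $1<p<\infty$, the space $V_p(\lambda)$ is a nearly uniformly convex Banach space, and it is reflexive. -/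

import Mathlib

open scoped Pointwise

/-- A nondecreasing sequence `Λ = (λ_k)_{k ≥ 1}` of positive reals tending to infinity with
`λ_1 = 1` and `λ_{k+1} ≤ λ_k + 1`. -/
structure VPSequence where
  lam : ℕ+ → ℝ
  pos : ∀ k, 0 < lam k
  mono : Monotone lam
  tendsto : Filter.Tendsto lam Filter.atTop Filter.atTop
  one : lam 1 = 1
  succ_le : ∀ k, lam (k + 1) ≤ lam k + 1

namespace VPSequence

/-- The set `I_k = [k - λ_k + 1, k]` of (positive integer) indices. -/
noncomputable def I (Λ : VPSequence) (k : ℕ+) : Finset ℕ+ :=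
  {j ∈ Finset.Icc 1 k | ((k : ℕ) : ℝ) - Λ.lam k + 1 ≤ ((j : ℕ) : ℝ)}

/-- The generalized de la Vallée-Poussin mean `(1 / λ_k) * ∑_{j ∈ I_k} |x_j|` of `|x|`. -/
noncomputable def absMean (Λ : VPSequence) (x : ℕ+ → ℝ) (k : ℕ+) : ℝ :=
  (1 / Λ.lam k) * ∑ j ∈ Λ.I k, |x j|

theorem one_le (Λ : VPSequence) (k : ℕ+) : 1 ≤ Λ.lam k :=
  Λ.one ▸ Λ.mono (_root_.one_le)

theorem self_mem_I (Λ : VPSequence) (k : ℕ+) : k ∈ Λ.I k := by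
  have := Λ.one_le k
  simp only [I, Finset.mem_filter, Finset.mem_Icc, _root_.one_le, le_refl, and_self, true_and]
  linarith

theorem absMean_nonneg (Λ : VPSequence) (x : ℕ+ → ℝ) (k : ℕ+) : 0 ≤ Λ.absMean x k :=
  mul_nonneg (one_div_nonneg.2 (Λ.pos k).le) (Finset.sum_nonneg fun _ _ => abs_nonneg _)

theorem absMean_add_le (Λ : VPSequence) (x y : ℕ+ → ℝ) (k : ℕ+) :
    Λ.absMean (x + y) k ≤ Λ.absMean x k + Λ.absMean y k := by
  unfold absMean
  rw [← mul_add, ← Finset.sum_add_distrib]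
  exact mul_le_mul_of_nonneg_left (Finset.sum_le_sum fun j _ => abs_add_le (x j) (y j))
    (one_div_nonneg.2 (Λ.pos k).le)

theorem absMean_smul (Λ : VPSequence) (c : ℝ) (x : ℕ+ → ℝ) (k : ℕ+) :
    Λ.absMean (c • x) k = |c| * Λ.absMean x k := by
  simp only [absMean, Pi.smul_apply, smul_eq_mul, abs_mul, ← Finset.mul_sum]
  ring

theorem eq_zero_of_absMean (Λ : VPSequence) (x : ℕ+ → ℝ) (k : ℕ+) (h : Λ.absMean x k = 0) :
    x k = 0 := by
  have h1 : ∑ j ∈ Λ.I k, |x j| = 0 :=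
    (mul_eq_zero.1 h).resolve_left (one_div_pos.2 (Λ.pos k)).ne'
  exact abs_eq_zero.1 ((Finset.sum_eq_zero_iff_of_nonneg fun _ _ => abs_nonneg _).1 h1 k
    (Λ.self_mem_I k))

theorem summable_and_norm_add_le (Λ : VPSequence) {p : ℝ} (hp : 1 < p) {x y : ℕ+ → ℝ}
    (hx : Summable fun k => Λ.absMean x k ^ p) (hy : Summable fun k => Λ.absMean y k ^ p) :
    (Summable fun k => Λ.absMean (x + y) k ^ p) ∧
      (∑' k, Λ.absMean (x + y) k ^ p) ^ (1 / p) ≤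
        (∑' k, Λ.absMean x k ^ p) ^ (1 / p) + (∑' k, Λ.absMean y k ^ p) ^ (1 / p) := by
  have hp0 : 0 < p := one_pos.trans hp
  have hle : ∀ k, Λ.absMean (x + y) k ^ p ≤ (Λ.absMean x k + Λ.absMean y k) ^ p := fun k =>
    Real.rpow_le_rpow (Λ.absMean_nonneg _ k) (Λ.absMean_add_le x y k) hp0.le
  have hS : Summable fun k => (Λ.absMean x k + Λ.absMean y k) ^ p :=
    Real.summable_Lp_add_of_nonneg hp.le (Λ.absMean_nonneg x) (Λ.absMean_nonneg y) hx hy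
  have hT := Real.Lp_add_le_tsum_of_nonneg' hp.le (Λ.absMean_nonneg x) (Λ.absMean_nonneg y) hx hy
  have h1 : Summable fun k => Λ.absMean (x + y) k ^ p :=
    Summable.of_nonneg_of_le (fun k => Real.rpow_nonneg (Λ.absMean_nonneg _ k) p) hle hS
  refine ⟨h1, le_trans ?_ hT⟩
  exact Real.rpow_le_rpow (tsum_nonneg fun k => Real.rpow_nonneg (Λ.absMean_nonneg _ k) p)
    (h1.tsum_le_tsum hle hS) (one_div_nonneg.2 hp0.le)

theorem absMean_smul_rpow (Λ : VPSequence) (p c : ℝ) (x : ℕ+ → ℝ) (k : ℕ+) :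
    Λ.absMean (c • x) k ^ p = |c| ^ p * Λ.absMean x k ^ p := by
  rw [absMean_smul, Real.mul_rpow (abs_nonneg c) (Λ.absMean_nonneg x k)]

/-- `V_p(λ)` as a linear subspace of the space of all real sequences. -/
noncomputable def subspace (Λ : VPSequence) (p : ℝ) [hp : Fact (1 < p)] :
    Submodule ℝ (ℕ+ → ℝ) where
  carrier := {x | Summable fun k => Λ.absMean x k ^ p}
  zero_mem' := by
    have h : ∀ k, Λ.absMean 0 k ^ p = 0 := fun k => by
      simp [absMean, Real.zero_rpow (one_pos.trans hp.out).ne']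
    simp only [Set.mem_ofPred_eq, h]
    exact summable_zero
  add_mem' hx hy := (Λ.summable_and_norm_add_le hp.out hx hy).1
  smul_mem' c x hx := by
    simp only [Set.mem_ofPred_eq, absMean_smul_rpow]
    exact Summable.mul_left _ hx

/-- The space `V_p(λ)`, `1 < p < ∞`. It is a type synonym of `Λ.subspace p`, so that it
carries the topology of its norm and not the topology of coordinatewise convergence. -/
def V (Λ : VPSequence) (p : ℝ) [Fact (1 < p)] : Type := Λ.subspace p

namespace V

noncomputable instance (Λ : VPSequence) (p : ℝ) [Fact (1 < p)] : AddCommGroup (Λ.V p) :=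
  inferInstanceAs (AddCommGroup (Λ.subspace p))

noncomputable instance (Λ : VPSequence) (p : ℝ) [Fact (1 < p)] : Module ℝ (Λ.V p) :=
  inferInstanceAs (Module ℝ (Λ.subspace p))

/-- `‖x‖ = (∑_{k ≥ 1} ((1 / λ_k) ∑_{j ∈ I_k} |x_j|) ^ p) ^ (1 / p)`. -/
noncomputable instance (Λ : VPSequence) (p : ℝ) [Fact (1 < p)] : Norm (Λ.V p) :=
  ⟨fun x => (∑' k, Λ.absMean x.1 k ^ p) ^ (1 / p)⟩

theorem norm_def (Λ : VPSequence) (p : ℝ) [Fact (1 < p)] (x : Λ.V p) :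
    ‖x‖ = (∑' k, Λ.absMean x.1 k ^ p) ^ (1 / p) := rfl

theorem core (Λ : VPSequence) (p : ℝ) [hp : Fact (1 < p)] : NormedSpace.Core ℝ (Λ.V p) where
  norm_nonneg x := Real.rpow_nonneg
    (tsum_nonneg fun k => Real.rpow_nonneg (Λ.absMean_nonneg _ k) p) _
  norm_smul c x := by
    have hp0 : 0 < p := one_pos.trans hp.out
    have h : ∀ k, Λ.absMean (c • x).1 k ^ p = |c| ^ p * Λ.absMean x.1 k ^ p :=
      Λ.absMean_smul_rpow p c x.1
    simp only [norm_def, h]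
    rw [tsum_mul_left, Real.mul_rpow (Real.rpow_nonneg (abs_nonneg c) p)
      (tsum_nonneg fun k => Real.rpow_nonneg (Λ.absMean_nonneg _ k) p),
      ← Real.rpow_mul (abs_nonneg c), mul_one_div_cancel hp0.ne', Real.rpow_one, Real.norm_eq_abs]
  norm_triangle x y := (Λ.summable_and_norm_add_le hp.out x.2 y.2).2
  norm_eq_zero_iff x := by
    have hp0 : 0 < p := one_pos.trans hp.out
    have hnn : ∀ k, 0 ≤ Λ.absMean x.1 k ^ p := fun k =>
      Real.rpow_nonneg (Λ.absMean_nonneg _ k) p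
    constructor
    · intro h
      rw [norm_def, Real.rpow_eq_zero (tsum_nonneg hnn) (one_div_pos.2 hp0).ne'] at h
      have hz := (hasSum_zero_iff_of_nonneg hnn).1 (h ▸ x.2.hasSum)
      refine Subtype.ext (funext fun k => Λ.eq_zero_of_absMean x.1 k ?_)
      exact (Real.rpow_eq_zero (Λ.absMean_nonneg _ k) hp0.ne').1 (congrFun hz k)
    · rintro rfl
      have h : ∀ k, Λ.absMean (0 : Λ.V p).1 k ^ p = 0 := fun k => by
        have h0 : (0 : Λ.V p).1 = (0 : ℕ+ → ℝ) := rfl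
        simp [h0, absMean, Real.zero_rpow hp0.ne']
      simp only [norm_def, h, tsum_zero]
      exact Real.zero_rpow (one_div_pos.2 hp0).ne'

noncomputable instance (Λ : VPSequence) (p : ℝ) [Fact (1 < p)] : NormedAddCommGroup (Λ.V p) :=
  NormedAddCommGroup.ofCore (core Λ p)

noncomputable instance (Λ : VPSequence) (p : ℝ) [Fact (1 < p)] : NormedSpace ℝ (Λ.V p) :=
  NormedSpace.ofCore (core Λ p)

end V

end VPSequence

/-- `sep {x_n} = inf {‖x_n - x_m‖ : n ≠ m}`. -/
noncomputable def sep {X : Type*} [NormedAddCommGroup X] (x : ℕ → X) : ℝ :=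
  sInf {r : ℝ | ∃ n m : ℕ, n ≠ m ∧ r = ‖x n - x m‖}

/-- `X` is a nearly uniformly convex Banach space. The bound `δ < 1` makes `(1 - δ) B(X)` the
closed ball of radius `1 - δ`. -/
def IsNearlyUniformlyConvex (X : Type*) [NormedAddCommGroup X] [NormedSpace ℝ X] : Prop :=
  CompleteSpace X ∧
    ∀ ε : ℝ, 0 < ε → ∃ δ : ℝ, 0 < δ ∧ δ < 1 ∧
      ∀ x : ℕ → X, (∀ n, x n ∈ Metric.closedBall (0 : X) 1) → ε < sep x →
        (convexHull ℝ (Set.range x) ∩ (1 - δ) • Metric.closedBall (0 : X) 1).Nonempty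

/-- `X` is reflexive: the canonical embedding of `X` in its bidual is onto. -/
def IsReflexiveSpace (X : Type*) [NormedAddCommGroup X] [NormedSpace ℝ X] : Prop :=
  Function.Surjective (NormedSpace.inclusionInDoubleDual ℝ X)

/-! For a fixed `u` and a bounded coordinatewise null sequence `y n`, the space behaves
asymptotically like an `ℓ_p`-sum. Up to errors tending to 0, `‖u + y n‖ ^ p` is at least `‖u‖ ^ p +
‖y n‖ ^ p` (`norm_rpow_add_rpow_le`) and at most that (`norm_add_le_rpow_add`); both errors vanish
by dominated convergence.

The lower estimate pushes the coordinatewise limit `y` of an `ε`-separated sequence of the unit ball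
inside it: `‖y‖ ^ p ≤ 1 - (ε / 2) ^ p`. The upper one makes suitable averages of null sequences
small, since sums of `N` terms grow only like `N ^ (1 / p)` and `p > 1`. Near uniform convexity
follows by averaging `x n - y` along a subsequence converging to `y`.

Reflexivity is James' criterion: averaging makes the unit vectors shrinking, Fatou's lemma makes
them boundedly complete. Completeness then comes for free. -/

open Filter Topology

namespace VPSequence

variable (Λ : VPSequence)

/-! ### Means of sequences and of unit vectors -/

theorem absMean_mono {x y : ℕ+ → ℝ} (h : ∀ j, |x j| ≤ |y j|) (k : ℕ+) :
    Λ.absMean x k ≤ Λ.absMean y k :=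
  mul_le_mul_of_nonneg_left (Finset.sum_le_sum fun j _ => h j) (one_div_nonneg.2 (Λ.pos k).le)

theorem abs_le_lam_mul_absMean (x : ℕ+ → ℝ) (k : ℕ+) : |x k| ≤ Λ.lam k * Λ.absMean x k := by
  have h := Finset.single_le_sum (f := fun j => |x j|) (fun j _ => abs_nonneg (x j))
    (Λ.self_mem_I k)
  rw [absMean, ← mul_assoc, mul_one_div_cancel (Λ.pos k).ne', one_mul]
  exact h

theorem tendsto_absMean {x : ℕ → ℕ+ → ℝ} {y : ℕ+ → ℝ}
    (h : ∀ j, Tendsto (fun n => x n j) atTop (𝓝 (y j))) (k : ℕ+) :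
    Tendsto (fun n => Λ.absMean (x n) k) atTop (𝓝 (Λ.absMean y k)) :=
  (tendsto_finsetSum _ fun j _ => (h j).abs).const_mul _

variable {Λ} {p : ℝ} [hp : Fact (1 < p)]

theorem absMean_single_le (Λ : VPSequence) (j k : ℕ+) :
    Λ.absMean (Pi.single j 1) k ≤ (j : ℕ) * (1 / ((k : ℕ) : ℝ)) := by
  have hk : (0 : ℝ) < (k : ℕ) := by exact_mod_cast k.pos
  have hj : (1 : ℝ) ≤ (j : ℕ) := by exact_mod_cast j.pos
  have hs : ∑ i ∈ Λ.I k, |(Pi.single j 1 : ℕ+ → ℝ) i| = if j ∈ Λ.I k then 1 else 0 := by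
    rw [← Finset.sum_ite_eq' (Λ.I k) j (fun _ => (1 : ℝ))]
    refine Finset.sum_congr rfl fun i _ => ?_
    by_cases hij : i = j <;> simp [hij]
  rw [absMean, hs]
  split_ifs with h
  · simp only [I, Finset.mem_filter, Finset.mem_Icc] at h
    have hjk : ((j : ℕ) : ℝ) ≤ (k : ℕ) := by exact_mod_cast h.1.2
    -- `j ∈ I_k` says `λ_k ≥ k - j + 1`, and `j * (k - j + 1) - k = (j - 1) * (k - j) ≥ 0`.
    rw [mul_one, mul_one_div, div_le_div_iff₀ (Λ.pos k) hk, one_mul]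
    nlinarith [mul_nonneg (sub_nonneg.2 hj) (sub_nonneg.2 hjk), h.2]
  · rw [mul_zero]; positivity

theorem single_mem (Λ : VPSequence) (j : ℕ+) : (Pi.single j 1 : ℕ+ → ℝ) ∈ Λ.subspace p := by
  have h : Summable fun k : ℕ+ => ((j : ℕ) : ℝ) ^ p * (1 / ((k : ℕ) : ℝ) ^ p) :=
    (((Real.summable_one_div_nat_rpow (p := p)).2 hp.out).comp_injective
      PNat.coe_injective).mul_left _
  refine Summable.of_nonneg_of_le (fun k => Real.rpow_nonneg (Λ.absMean_nonneg _ k) p)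
    (fun k => ?_) h
  refine (Real.rpow_le_rpow (Λ.absMean_nonneg _ k) (Λ.absMean_single_le j k)
    (one_pos.trans hp.out).le).trans_eq ?_
  rw [Real.mul_rpow (Nat.cast_nonneg _) (by positivity), Real.div_rpow zero_le_one
    (Nat.cast_nonneg _), Real.one_rpow]

namespace V

/-! ### Lattice norm and limit theorems -/

theorem norm_rpow (x : Λ.V p) : ‖x‖ ^ p = ∑' k, Λ.absMean x.1 k ^ p := by
  rw [norm_def, ← Real.rpow_mul (tsum_nonneg fun k => Real.rpow_nonneg (Λ.absMean_nonneg _ k) p),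
    one_div_mul_cancel (one_pos.trans hp.out).ne', Real.rpow_one]

theorem absMean_le_norm (x : Λ.V p) (k : ℕ+) : Λ.absMean x.1 k ≤ ‖x‖ := by
  have h := x.2.le_tsum k fun k _ => Real.rpow_nonneg (Λ.absMean_nonneg _ k) p
  rw [← norm_rpow] at h
  exact (Real.rpow_le_rpow_iff (Λ.absMean_nonneg _ k) (norm_nonneg x)
    (one_pos.trans hp.out)).1 h

theorem abs_coord_le (x : Λ.V p) (k : ℕ+) : |x.1 k| ≤ Λ.lam k * ‖x‖ :=
  (Λ.abs_le_lam_mul_absMean x.1 k).trans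
    (mul_le_mul_of_nonneg_left (absMean_le_norm x k) (Λ.pos k).le)

theorem mem_of_abs_le {x : ℕ+ → ℝ} (y : Λ.V p) (h : ∀ j, |x j| ≤ |y.1 j|) :
    x ∈ Λ.subspace p :=
  Summable.of_nonneg_of_le (fun k => Real.rpow_nonneg (Λ.absMean_nonneg _ k) p)
    (fun k => Real.rpow_le_rpow (Λ.absMean_nonneg _ k) (Λ.absMean_mono h k)
      (one_pos.trans hp.out).le) y.2

theorem norm_le_of_abs_le {x y : Λ.V p} (h : ∀ j, |x.1 j| ≤ |y.1 j|) : ‖x‖ ≤ ‖y‖ := by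
  have hp0 : 0 < p := one_pos.trans hp.out
  rw [← Real.rpow_le_rpow_iff (norm_nonneg x) (norm_nonneg y) hp0, norm_rpow, norm_rpow]
  exact x.2.tsum_le_tsum (fun k => Real.rpow_le_rpow (Λ.absMean_nonneg _ k)
    (Λ.absMean_mono h k) hp0.le) y.2

/-- Fatou's lemma in `V_p(λ)`. -/
theorem exists_eq_of_tendsto {x : ℕ → Λ.V p} {y : ℕ+ → ℝ} {C : ℝ} (hC : ∀ n, ‖x n‖ ≤ C)
    (h : ∀ j, Tendsto (fun n => (x n).1 j) atTop (𝓝 (y j))) :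
    ∃ z : Λ.V p, z.1 = y ∧ ‖z‖ ≤ C := by
  have hp0 : 0 < p := one_pos.trans hp.out
  have hC0 : 0 ≤ C := (norm_nonneg _).trans (hC 0)
  have hnn : ∀ k, 0 ≤ Λ.absMean y k ^ p := fun k => Real.rpow_nonneg (Λ.absMean_nonneg _ k) p
  have hs : ∀ s : Finset ℕ+, ∑ k ∈ s, Λ.absMean y k ^ p ≤ C ^ p := fun s => by
    refine le_of_tendsto (tendsto_finsetSum s fun k _ =>
      (Λ.tendsto_absMean h k).rpow_const (Or.inr hp0.le)) (Eventually.of_forall fun n => ?_)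
    refine ((x n).2.sum_le_tsum s fun k _ =>
      Real.rpow_nonneg (Λ.absMean_nonneg _ k) p).trans ?_
    rw [← norm_rpow]
    exact Real.rpow_le_rpow (norm_nonneg _) (hC n) hp0.le
  have hy : Summable fun k => Λ.absMean y k ^ p := summable_of_sum_le hnn hs
  let z : Λ.V p := ⟨y, hy⟩
  refine ⟨z, rfl, ?_⟩
  rw [← Real.rpow_le_rpow_iff (norm_nonneg z) hC0 hp0, norm_rpow]
  exact hy.tsum_le_of_sum_le hs

/-- Dominated convergence in `V_p(λ)`. -/
theorem tendsto_norm_zero_of_dominated {w : ℕ → Λ.V p} (x : Λ.V p)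
    (hw : ∀ n j, |(w n).1 j| ≤ |x.1 j|) (h : ∀ j, Tendsto (fun n => (w n).1 j) atTop (𝓝 0)) :
    Tendsto (fun n => ‖w n‖) atTop (𝓝 0) := by
  have hp0 : 0 < p := one_pos.trans hp.out
  have hz : ∀ k, Tendsto (fun n => Λ.absMean (w n).1 k ^ p) atTop (𝓝 0) := fun k => by
    have h0 : Λ.absMean (fun _ => 0) k = 0 := by simp [absMean]
    have := (Λ.tendsto_absMean (y := fun _ => 0) h k).rpow_const (Or.inr hp0.le)
    rwa [h0, Real.zero_rpow hp0.ne'] at this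
  have ht := tendsto_tsum_of_dominated_convergence x.2 hz (Eventually.of_forall fun n k => by
    rw [Real.norm_of_nonneg (Real.rpow_nonneg (Λ.absMean_nonneg _ k) p)]
    exact Real.rpow_le_rpow (Λ.absMean_nonneg _ k) (Λ.absMean_mono (hw n) k) hp0.le)
  rw [tsum_zero] at ht
  have := ht.rpow_const (p := 1 / p) (Or.inr (one_div_nonneg.2 hp0.le))
  rwa [Real.zero_rpow (one_div_pos.2 hp0).ne'] at this

/-! ### Asymptotic `ℓ_p` estimates -/

/-- The pointwise minimum of `|x|` and `|y|`. -/
noncomputable def absInf (x y : Λ.V p) : Λ.V p :=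
  ⟨fun j => min |x.1 j| |y.1 j|, mem_of_abs_le x fun j => by
    rw [abs_of_nonneg (le_min (abs_nonneg _) (abs_nonneg _))]; exact min_le_left _ _⟩

theorem tendsto_norm_absInf (x : Λ.V p) {y : ℕ → Λ.V p}
    (h : ∀ j, Tendsto (fun n => (y n).1 j) atTop (𝓝 0)) :
    Tendsto (fun n => ‖absInf x (y n)‖) atTop (𝓝 0) := by
  refine tendsto_norm_zero_of_dominated x (fun n j => ?_) fun j => ?_
  · change abs (min |x.1 j| |(y n).1 j|) ≤ _
    rw [abs_of_nonneg (le_min (abs_nonneg _) (abs_nonneg _))]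
    exact min_le_left _ _
  · exact squeeze_zero (fun n => le_min (abs_nonneg _) (abs_nonneg _))
      (fun n => min_le_right _ _) (by simpa using (h j).abs)

/-- The coordinatewise absolute value. -/
noncomputable def absV (x : Λ.V p) : Λ.V p :=
  ⟨fun j => |x.1 j|, mem_of_abs_le x fun _ => (abs_abs _).le⟩

/-- Means are additive on nonnegative sequences, and `a ^ p + b ^ p ≤ (a + b) ^ p` holds termwise.
-/
theorem norm_rpow_add_le_norm_absV_add (x y : Λ.V p) :
    ‖x‖ ^ p + ‖y‖ ^ p ≤ ‖absV x + absV y‖ ^ p := by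
  rw [norm_rpow, norm_rpow, norm_rpow, ← x.2.tsum_add y.2]
  refine (x.2.add y.2).tsum_le_tsum (fun k => ?_) (absV x + absV y).2
  have h : Λ.absMean (absV x + absV y).1 k = Λ.absMean x.1 k + Λ.absMean y.1 k := by
    unfold absMean
    rw [← mul_add, ← Finset.sum_add_distrib]
    congr 1
    exact Finset.sum_congr rfl fun j _ => abs_of_nonneg (add_nonneg (abs_nonneg _) (abs_nonneg _))
  rw [h]
  exact Real.add_rpow_le_rpow_add (Λ.absMean_nonneg _ k) (Λ.absMean_nonneg _ k) hp.out.le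

/-- Rests on `|a| + |b| ≤ |a + b| + 2 * min |a| |b|` in each coordinate. -/
theorem norm_rpow_add_rpow_le (x y : Λ.V p) :
    (‖x‖ ^ p + ‖y‖ ^ p) ^ (1 / p) ≤ ‖x + y‖ + 2 * ‖absInf x y‖ := by
  have hp0 : 0 < p := one_pos.trans hp.out
  have h1 : (‖x‖ ^ p + ‖y‖ ^ p) ^ (1 / p) ≤ ‖absV x + absV y‖ := by
    rw [one_div, Real.rpow_inv_le_iff_of_pos (by positivity) (norm_nonneg _) hp0]
    exact norm_rpow_add_le_norm_absV_add x y
  have h2 : ‖absV x + absV y‖ ≤ ‖absV (x + y) + (2 : ℝ) • absInf x y‖ := by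
    refine norm_le_of_abs_le fun j => ?_
    change abs (|x.1 j| + |y.1 j|) ≤ abs (|x.1 j + y.1 j| + 2 * min (|x.1 j|) (|y.1 j|))
    rw [abs_of_nonneg (add_nonneg (abs_nonneg (x.1 j)) (abs_nonneg (y.1 j)))]
    refine le_trans ?_ (le_abs_self _)
    have ha := abs_sub_abs_le_abs_sub (x.1 j) (-y.1 j)
    have hb := abs_sub_abs_le_abs_sub (y.1 j) (-x.1 j)
    rw [abs_neg, sub_neg_eq_add] at ha hb
    rw [add_comm (y.1 j)] at hb
    rcases min_cases (|x.1 j|) (|y.1 j|) with h | h <;> linarith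
  have h3 : ‖absV (x + y)‖ ≤ ‖x + y‖ := norm_le_of_abs_le fun j => (abs_abs _).le
  calc _ ≤ _ := h1
    _ ≤ _ := h2
    _ ≤ ‖absV (x + y)‖ + ‖(2 : ℝ) • absInf x y‖ := norm_add_le _ _
    _ ≤ _ := by rw [norm_smul]; norm_num; exact h3

/-- Minkowski applied to `a + b = max a b + min a b` for the means, with `max a b ^ p ≤ a ^ p + b ^
p`. Disjoint vectors can have overlapping means, so the error here involves minima of means, not of
coordinates. -/
theorem norm_add_le_rpow_add (x y : Λ.V p) :
    ‖x + y‖ ≤ (‖x‖ ^ p + ‖y‖ ^ p) ^ (1 / p) +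
      (∑' k, min (Λ.absMean x.1 k) (Λ.absMean y.1 k) ^ p) ^ (1 / p) := by
  have hp0 : 0 < p := one_pos.trans hp.out
  have hx0 := Λ.absMean_nonneg x.1
  have hy0 := Λ.absMean_nonneg y.1
  have hM0 : ∀ k, 0 ≤ max (Λ.absMean x.1 k) (Λ.absMean y.1 k) := fun k => le_max_of_le_left (hx0 k)
  have hm0 : ∀ k, 0 ≤ min (Λ.absMean x.1 k) (Λ.absMean y.1 k) := fun k => le_min (hx0 k) (hy0 k)
  have hMle : ∀ k, max (Λ.absMean x.1 k) (Λ.absMean y.1 k) ^ p ≤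
      Λ.absMean x.1 k ^ p + Λ.absMean y.1 k ^ p := fun k => by
    have h1 := Real.rpow_nonneg (hx0 k) p
    have h2 := Real.rpow_nonneg (hy0 k) p
    rcases max_cases (Λ.absMean x.1 k) (Λ.absMean y.1 k) with h | h <;> rw [h.1] <;> linarith
  have hS := x.2.add y.2
  have hM : Summable fun k => max (Λ.absMean x.1 k) (Λ.absMean y.1 k) ^ p :=
    Summable.of_nonneg_of_le (fun k => Real.rpow_nonneg (hM0 k) p) hMle hS
  have hm : Summable fun k => min (Λ.absMean x.1 k) (Λ.absMean y.1 k) ^ p :=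
    Summable.of_nonneg_of_le (fun k => Real.rpow_nonneg (hm0 k) p)
      (fun k => Real.rpow_le_rpow (hm0 k) (min_le_left _ _) hp0.le) x.2
  have hadd := Real.Lp_add_le_tsum_of_nonneg' hp.out.le hM0 hm0 hM hm
  have hsum := Real.summable_Lp_add_of_nonneg hp.out.le hM0 hm0 hM hm
  refine le_trans ?_ (hadd.trans (add_le_add_left ?_ _))
  · refine Real.rpow_le_rpow (tsum_nonneg fun k => Real.rpow_nonneg (Λ.absMean_nonneg _ k) p)
      ((x + y).2.tsum_le_tsum (fun k => ?_) hsum) (one_div_nonneg.2 hp0.le)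
    rw [max_add_min]
    exact Real.rpow_le_rpow (Λ.absMean_nonneg _ k) (Λ.absMean_add_le x.1 y.1 k) hp0.le
  · rw [norm_rpow, norm_rpow, ← x.2.tsum_add y.2]
    exact Real.rpow_le_rpow (tsum_nonneg fun k => Real.rpow_nonneg (hM0 k) p)
      (hM.tsum_le_tsum hMle hS) (one_div_nonneg.2 hp0.le)

theorem tendsto_tsum_min_absMean (x : Λ.V p) {y : ℕ → Λ.V p}
    (h : ∀ j, Tendsto (fun n => (y n).1 j) atTop (𝓝 0)) :
    Tendsto (fun n => (∑' k, min (Λ.absMean x.1 k) (Λ.absMean (y n).1 k) ^ p) ^ (1 / p))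
      atTop (𝓝 0) := by
  have hp0 : 0 < p := one_pos.trans hp.out
  have hm0 : ∀ n k, 0 ≤ min (Λ.absMean x.1 k) (Λ.absMean (y n).1 k) := fun n k =>
    le_min (Λ.absMean_nonneg _ k) (Λ.absMean_nonneg _ k)
  have hz : ∀ k, Tendsto (fun n => min (Λ.absMean x.1 k) (Λ.absMean (y n).1 k) ^ p)
      atTop (𝓝 0) := fun k => by
    have h0 : Λ.absMean (fun _ => 0) k = 0 := by simp [absMean]
    have h1 := Λ.tendsto_absMean (y := fun _ => 0) h k
    rw [h0] at h1
    have := (squeeze_zero (fun n => hm0 n k) (fun n => min_le_right _ _) h1).rpow_const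
      (p := p) (Or.inr hp0.le)
    rwa [Real.zero_rpow hp0.ne'] at this
  have ht := tendsto_tsum_of_dominated_convergence x.2 hz (Eventually.of_forall fun n k => by
    rw [Real.norm_of_nonneg (Real.rpow_nonneg (hm0 n k) p)]
    exact Real.rpow_le_rpow (hm0 n k) (min_le_left _ _) hp0.le)
  rw [tsum_zero] at ht
  have := ht.rpow_const (p := 1 / p) (Or.inr (one_div_nonneg.2 hp0.le))
  rwa [Real.zero_rpow (one_div_pos.2 hp0).ne'] at this

theorem exists_norm_add_rpow_le (u : Λ.V p) {y : ℕ → Λ.V p} {M : ℝ} (hM : ∀ n, ‖y n‖ ≤ M)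
    (h : ∀ j, Tendsto (fun n => (y n).1 j) atTop (𝓝 0)) :
    ∃ n, ‖u + y n‖ ^ p ≤ ‖u‖ ^ p + (M ^ p + 1) := by
  have hp0 : 0 < p := one_pos.trans hp.out
  have hM0 : 0 ≤ M := (norm_nonneg _).trans (hM 0)
  have hnn : 0 ≤ ‖u‖ ^ p + M ^ p := by positivity
  have ht := ((tendsto_tsum_min_absMean u h).const_add
    ((‖u‖ ^ p + M ^ p) ^ (1 / p))).rpow_const (p := p) (Or.inr hp0.le)
  rw [add_zero, ← Real.rpow_mul hnn, one_div_mul_cancel hp0.ne', Real.rpow_one] at ht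
  obtain ⟨n, hn⟩ := (ht.eventually (gt_mem_nhds (lt_add_one _))).exists
  -- The slack 1 absorbs the error term for large `n`.
  refine ⟨n, (Real.rpow_le_rpow (norm_nonneg _) ?_ hp0.le).trans (hn.le.trans_eq (add_assoc _ _ _))⟩
  refine (norm_add_le_rpow_add u (y n)).trans (add_le_add_left ?_ _)
  exact Real.rpow_le_rpow (by positivity)
    (by gcongr; exact hM n) (one_div_nonneg.2 hp0.le)

/-- The convex hull of a bounded coordinatewise null sequence contains arbitrarily short
vectors. -/
theorem exists_mem_convexHull_norm_lt {y : ℕ → Λ.V p} {M : ℝ} (hM : ∀ n, ‖y n‖ ≤ M)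
    (h : ∀ j, Tendsto (fun n => (y n).1 j) atTop (𝓝 0)) {η : ℝ} (hη : 0 < η) :
    ∃ z ∈ convexHull ℝ (Set.range y), ‖z‖ < η := by
  have hp0 : 0 < p := one_pos.trans hp.out
  have hM0 : 0 ≤ M := (norm_nonneg _).trans (hM 0)
  have key : ∀ N : ℕ, ∃ z ∈ convexHull ℝ (Set.range y),
      ‖((N : ℝ) + 1) • z‖ ^ p ≤ ((N : ℝ) + 1) * (M ^ p + 1) := by
    intro N
    induction N with
    | zero =>
      refine ⟨y 0, subset_convexHull ℝ _ ⟨0, rfl⟩, ?_⟩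
      have := Real.rpow_le_rpow (norm_nonneg _) (hM 0) hp0.le
      simp only [Nat.cast_zero, zero_add, one_smul, one_mul]
      linarith
    | succ N ih =>
      obtain ⟨z, hz, hzN⟩ := ih
      obtain ⟨n, hn⟩ := exists_norm_add_rpow_le (((N : ℝ) + 1) • z) hM h
      have hN : (0 : ℝ) < (N : ℝ) + 1 + 1 := by positivity
      -- Weights chosen so that `N + 2` times the new point is `(N + 1) • z + y n`.
      refine ⟨(((N : ℝ) + 1) / ((N : ℝ) + 1 + 1)) • z + (1 / ((N : ℝ) + 1 + 1)) • y n,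
        convex_convexHull ℝ _ hz (subset_convexHull ℝ _ ⟨n, rfl⟩) (by positivity)
          (by positivity) (by field_simp), ?_⟩
      push_cast
      rw [smul_add, smul_smul, smul_smul, mul_div_cancel₀ _ hN.ne', mul_one_div_cancel hN.ne',
        one_smul]
      linarith
  have hlim : Tendsto (fun N : ℕ => (M ^ p + 1) * ((N : ℝ) + 1) ^ (-(p - 1))) atTop (𝓝 0) := by
    have := ((tendsto_rpow_neg_atTop (sub_pos.2 hp.out)).comp
      (tendsto_atTop_add_const_right atTop (1 : ℝ) tendsto_natCast_atTop_atTop)).const_mul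
      (M ^ p + 1)
    rwa [mul_zero] at this
  obtain ⟨N, hN⟩ := (hlim.eventually (gt_mem_nhds (Real.rpow_pos_of_pos hη p))).exists
  obtain ⟨z, hz, hzN⟩ := key N
  refine ⟨z, hz, (Real.rpow_lt_rpow_iff (norm_nonneg _) hη.le hp0).1 (lt_of_le_of_lt ?_ hN)⟩
  have hN0 : (0 : ℝ) < (N : ℝ) + 1 := by positivity
  rw [norm_smul, Real.norm_of_nonneg hN0.le, Real.mul_rpow hN0.le (norm_nonneg _)] at hzN
  rw [neg_sub, Real.rpow_sub hN0, Real.rpow_one, ← mul_div_assoc,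
    le_div_iff₀ (Real.rpow_pos_of_pos hN0 p)]
  linarith

/-! ### Unit vector basis and reflexivity -/

/-- The coordinate functional `x ↦ x_j`. -/
noncomputable def coord (Λ : VPSequence) (p : ℝ) [Fact (1 < p)] (j : ℕ+) : Λ.V p →L[ℝ] ℝ :=
  LinearMap.mkContinuous
    { toFun := fun x => x.1 j, map_add' := fun _ _ => rfl, map_smul' := fun _ _ => rfl }
    (Λ.lam j) fun x => abs_coord_le x j

/-- The unit vector `e_j`. -/
noncomputable def unit (Λ : VPSequence) (p : ℝ) [Fact (1 < p)] (j : ℕ+) : Λ.V p :=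
  ⟨Pi.single j 1, Λ.single_mem j⟩

theorem sum_smul_unit_apply (s : Finset ℕ+) (c : ℕ+ → ℝ) (k : ℕ+) :
    (∑ j ∈ s, c j • unit Λ p j).1 k = if k ∈ s then c k else 0 := by
  change coord Λ p k (∑ j ∈ s, c j • unit Λ p j) = _
  rw [map_sum, ← Finset.sum_ite_eq s k c]
  refine Finset.sum_congr rfl fun j _ => ?_
  rw [map_smul]
  change c j * (Pi.single j 1 : ℕ+ → ℝ) k = _
  simp [Pi.single_apply]

/-- The projection onto the coordinates in `s`. -/
noncomputable def proj (s : Finset ℕ+) : Λ.V p →L[ℝ] Λ.V p :=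
  ∑ j ∈ s, (coord Λ p j).smulRight (unit Λ p j)

theorem proj_eq (s : Finset ℕ+) (x : Λ.V p) : proj s x = ∑ j ∈ s, x.1 j • unit Λ p j := by
  simp only [proj, sum_apply, ContinuousLinearMap.smulRight_apply]
  rfl

theorem proj_apply (s : Finset ℕ+) (x : Λ.V p) (k : ℕ+) :
    (proj s x).1 k = if k ∈ s then x.1 k else 0 := by
  rw [proj_eq, sum_smul_unit_apply]

theorem norm_proj_le (s : Finset ℕ+) (x : Λ.V p) : ‖proj s x‖ ≤ ‖x‖ :=
  norm_le_of_abs_le fun j => by rw [proj_apply]; split_ifs <;> simp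

theorem norm_sub_proj_le (s : Finset ℕ+) (x : Λ.V p) : ‖x - proj s x‖ ≤ ‖x‖ :=
  norm_le_of_abs_le fun j => by
    change |x.1 j - (proj s x).1 j| ≤ _
    rw [proj_apply]; split_ifs <;> simp

theorem eventually_mem_Icc (k : ℕ+) : ∀ᶠ n : ℕ in atTop, k ∈ Finset.Icc 1 n.succPNat := by
  filter_upwards [eventually_ge_atTop (k : ℕ)] with n hn
  rw [Finset.mem_Icc]
  exact ⟨_root_.one_le, PNat.coe_le_coe _ _ |>.1 (by rw [Nat.succPNat_coe]; omega)⟩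

/-- The unit vectors form a shrinking basis. -/
theorem exists_norm_sub_proj_le (f : StrongDual ℝ (Λ.V p)) {η : ℝ} (hη : 0 < η) :
    ∃ n : ℕ, ∀ x, |f (x - proj (Finset.Icc 1 n.succPNat) x)| ≤ η * ‖x‖ := by
  by_contra! hcon
  choose u hu using hcon
  have hu0 : ∀ n, 0 < ‖u n‖ := fun n => by
    rw [norm_pos_iff]
    intro h0
    have := hu n
    simp [h0] at this
  set q : ℕ → Λ.V p := fun n => u n - proj (Finset.Icc 1 n.succPNat) (u n) with hq
  -- Normalizes the tails and fixes signs, so that `f ≥ η` on their whole convex hull, which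
  -- nevertheless contains short vectors.
  set c : ℕ → ℝ := fun n => SignType.sign (f (q n)) / ‖u n‖ with hc
  have hcabs : ∀ n, |c n| ≤ ‖u n‖⁻¹ := fun n => by
    rw [hc, abs_div, abs_norm, div_eq_mul_inv]
    refine mul_le_of_le_one_left (inv_nonneg.2 (norm_nonneg _)) ?_
    rcases lt_trichotomy (f (q n)) 0 with h | h | h <;> simp [h]
  obtain ⟨z, hz, hzlt⟩ := exists_mem_convexHull_norm_lt (y := fun n => c n • q n) (M := 1)
    (fun n => by
      rw [norm_smul, Real.norm_eq_abs]
      calc |c n| * ‖q n‖ ≤ ‖u n‖⁻¹ * ‖u n‖ :=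
            mul_le_mul (hcabs n) (norm_sub_proj_le _ _) (norm_nonneg _)
              (inv_nonneg.2 (norm_nonneg _))
        _ = 1 := inv_mul_cancel₀ (hu0 n).ne')
    (fun j => by
      refine tendsto_const_nhds.congr' ?_
      filter_upwards [eventually_mem_Icc j] with n hn
      change 0 = c n * ((u n).1 j - (proj (Finset.Icc 1 n.succPNat) (u n)).1 j)
      rw [proj_apply, if_pos hn, sub_self, mul_zero])
    (η := η / (‖f‖ + 1)) (by positivity)
  have hsub : convexHull ℝ (Set.range fun n => c n • q n) ⊆ {z | η ≤ f z} := by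
    refine convexHull_min ?_ (convex_halfSpace_ge f.isLinear η)
    rintro _ ⟨n, rfl⟩
    change η ≤ f (c n • q n)
    rw [map_smul, smul_eq_mul, hc]
    change η ≤ (SignType.sign (f (q n)) : ℝ) / ‖u n‖ * f (q n)
    rw [div_mul_eq_mul_div, sign_mul_self, le_div_iff₀ (hu0 n)]
    exact (hu n).le
  have h1 : η ≤ f z := hsub hz
  have h2 := (le_abs_self _).trans (f.le_opNorm z)
  have h3 : (‖f‖ + 1) * ‖z‖ < η := by
    rwa [mul_comm, ← lt_div_iff₀ (by positivity)]
  nlinarith [norm_nonneg z]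

theorem isReflexiveSpace (Λ : VPSequence) (p : ℝ) [Fact (1 < p)] :
    IsReflexiveSpace (Λ.V p) := by
  intro φ
  set P : ℕ → Λ.V p := fun n =>
    ∑ j ∈ Finset.Icc 1 n.succPNat, φ (coord Λ p j) • unit Λ p j with hP
  have hφ : ∀ n (f : StrongDual ℝ (Λ.V p)),
      φ (f.comp (proj (Finset.Icc 1 n.succPNat))) = f (P n) := fun n f => by
    have : f.comp (proj (Finset.Icc 1 n.succPNat)) =
        ∑ j ∈ Finset.Icc 1 n.succPNat, f (unit Λ p j) • coord Λ p j := by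
      ext x
      simp only [ContinuousLinearMap.comp_apply, proj_eq, map_sum, map_smul,
        sum_apply, smul_apply, smul_eq_mul]
      exact Finset.sum_congr rfl fun j _ => mul_comm _ _
    rw [this, hP]
    simp only [map_sum, map_smul, smul_eq_mul]
    exact Finset.sum_congr rfl fun j _ => mul_comm _ _
  have hPle : ∀ n, ‖P n‖ ≤ ‖φ‖ := fun n => by
    obtain ⟨g, hg, hgP⟩ := exists_dual_vector'' ℝ (P n)
    have h1 : ‖g.comp (proj (Finset.Icc 1 n.succPNat))‖ ≤ 1 :=
      ContinuousLinearMap.opNorm_le_bound _ zero_le_one fun x =>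
        (g.le_opNorm _).trans (mul_le_mul hg (norm_proj_le _ x) (norm_nonneg _) zero_le_one)
    have h2 := (le_abs_self _).trans (φ.le_opNorm (g.comp (proj (Finset.Icc 1 n.succPNat))))
    rw [hφ, hgP] at h2
    exact h2.trans (mul_le_of_le_one_right (norm_nonneg _) h1)
  -- The only candidate for a preimage of `φ` has coordinates `φ (coord Λ p j)`; Fatou puts it in
  -- the space.
  obtain ⟨x, hx, -⟩ := exists_eq_of_tendsto (y := fun j => φ (coord Λ p j)) hPle fun j => by
    refine tendsto_const_nhds.congr' ?_
    filter_upwards [eventually_mem_Icc j] with n hn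
    rw [hP, sum_smul_unit_apply, if_pos hn]
  refine ⟨x, ?_⟩
  ext f
  rw [NormedSpace.dual_def, ← sub_eq_zero, ← abs_nonpos_iff]
  have hlim : Tendsto (fun η : ℝ => η * (‖x‖ + ‖φ‖)) (𝓝[>] 0) (𝓝 0) := by
    have := (tendsto_id.mul_const (‖x‖ + ‖φ‖) : Tendsto (fun η : ℝ => η * (‖x‖ + ‖φ‖)) (𝓝 0) _)
    rw [zero_mul] at this
    exact this.mono_left nhdsWithin_le_nhds
  refine ge_of_tendsto hlim (eventually_mem_nhdsWithin.mono fun η hη => ?_)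
  obtain ⟨n, hn⟩ := exists_norm_sub_proj_le f hη
  have hPx : proj (Finset.Icc 1 n.succPNat) x = P n := by rw [proj_eq, hx]
  have h1 := hn x
  -- Shrinking makes `f.comp (proj _)` close to `f` in norm, and on it `φ` and `x` agree.
  have h2 : ‖f - f.comp (proj (Finset.Icc 1 n.succPNat))‖ ≤ η :=
    ContinuousLinearMap.opNorm_le_bound _ (le_of_lt hη) fun x => by
      have := hn x
      rwa [map_sub] at this
  have h3 := (φ.le_opNorm _).trans (mul_le_mul_of_nonneg_left h2 (norm_nonneg φ))
  rw [map_sub, hφ, Real.norm_eq_abs] at h3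
  rw [map_sub, hPx] at h1
  rw [abs_le] at h1 h3 ⊢
  constructor <;> linarith [h1.1, h1.2, h3.1, h3.2]

end V

end VPSequence

/-! ### Completeness and near uniform convexity -/

theorem IsReflexiveSpace.completeSpace {X : Type*} [NormedAddCommGroup X] [NormedSpace ℝ X]
    (h : IsReflexiveSpace X) : CompleteSpace X := by
  have hi := (NormedSpace.inclusionInDoubleDualLi ℝ (E := X)).isometry
  have hs : Function.Surjective (NormedSpace.inclusionInDoubleDualLi ℝ (E := X)) := h
  rw [completeSpace_iff_isComplete_range hi.isUniformInducing, hs.range_eq]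
  exact completeSpace_iff_isComplete_univ.1 inferInstance

theorem lt_norm_sub_of_lt_sep {X : Type*} [NormedAddCommGroup X] {x : ℕ → X} {ε : ℝ}
    (h : ε < sep x) {n m : ℕ} (hnm : n ≠ m) : ε < ‖x n - x m‖ :=
  h.trans_le (csInf_le ⟨0, by rintro _ ⟨n, m, -, rfl⟩; exact norm_nonneg _⟩ ⟨n, m, hnm, rfl⟩)

namespace VPSequence.V

variable {Λ : VPSequence} {p : ℝ} [hp : Fact (1 < p)]

/-- Tychonoff on a countable product of intervals; Fatou keeps the limit in the ball. -/
theorem exists_subseq_tendsto {x : ℕ → Λ.V p} {M : ℝ} (hM : ∀ n, ‖x n‖ ≤ M) :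
    ∃ y : Λ.V p, ‖y‖ ≤ M ∧ ∃ s : ℕ → ℕ, StrictMono s ∧
      ∀ j, Tendsto (fun n => (x (s n)).1 j) atTop (𝓝 (y.1 j)) := by
  have hc : IsCompact (Set.univ.pi fun j : ℕ+ => Set.Icc (-(Λ.lam j * M)) (Λ.lam j * M)) :=
    isCompact_univ_pi fun _ => isCompact_Icc
  obtain ⟨y, -, s, hs, hy⟩ := hc.tendsto_subseq (x := fun n => (x n).1) fun n j _ =>
    abs_le.1 ((abs_coord_le (x n) j).trans (mul_le_mul_of_nonneg_left (hM n) (Λ.pos j).le))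
  rw [tendsto_pi_nhds] at hy
  obtain ⟨z, rfl, hzM⟩ := exists_eq_of_tendsto (x := x ∘ s) (fun n => hM _) hy
  exact ⟨z, hzM, s, hs, hy⟩

/-- The coordinatewise limit of a separated sequence in the unit ball lies deep inside the
ball. -/
theorem norm_rpow_add_le_one {x : ℕ → Λ.V p} {y : Λ.V p} {ε : ℝ} (hε : 0 < ε)
    (hx : ∀ n, ‖x n‖ ≤ 1) (hsep : ∀ n m, n ≠ m → ε < ‖x n - x m‖)
    (h : ∀ j, Tendsto (fun n => (x n).1 j) atTop (𝓝 (y.1 j))) :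
    ‖y‖ ^ p + (ε / 2) ^ p ≤ 1 := by
  have hp0 : 0 < p := one_pos.trans hp.out
  have h0 : ∀ j, Tendsto (fun n => (x n - y).1 j) atTop (𝓝 0) := fun j => by
    have := (h j).sub_const (y.1 j)
    rwa [sub_self] at this
  have hw := tendsto_norm_absInf y h0
  have hle : ∀ n, (‖y‖ ^ p + ‖x n - y‖ ^ p) ^ (1 / p) ≤ 1 + 2 * ‖absInf y (x n - y)‖ := fun n => by
    refine (norm_rpow_add_rpow_le y (x n - y)).trans (add_le_add_left ?_ _)
    rw [add_sub_cancel]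
    exact hx n
  have hmono : ∀ n, ε / 2 ≤ ‖x n - y‖ → (‖y‖ ^ p + (ε / 2) ^ p) ^ (1 / p) ≤
      1 + 2 * ‖absInf y (x n - y)‖ := fun n hn => by
    refine le_trans ?_ (hle n)
    gcongr
  -- One of `x n`, `x (n + 1)` is at least `ε / 2` from `y`; adding both errors avoids choosing
  -- which.
  have hb : ∀ n, (‖y‖ ^ p + (ε / 2) ^ p) ^ (1 / p) ≤
      1 + 2 * ‖absInf y (x n - y)‖ + 2 * ‖absInf y (x (n + 1) - y)‖ := fun n => by
    have h1 := norm_nonneg (absInf y (x n - y))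
    have h2 := norm_nonneg (absInf y (x (n + 1) - y))
    by_cases hn : ε / 2 ≤ ‖x n - y‖
    · linarith [hmono n hn]
    · have h3 := hsep n (n + 1) (Nat.succ_ne_self n).symm
      have h4 := norm_sub_le (x n - y) (x (n + 1) - y)
      rw [sub_sub_sub_cancel_right] at h4
      linarith [hmono (n + 1) (by linarith [not_le.1 hn])]
  have hlim := ((hw.const_mul 2).const_add 1).add ((hw.comp (tendsto_add_atTop_nat 1)).const_mul 2)
  have hfin := ge_of_tendsto' hlim hb
  simp only [mul_zero, add_zero] at hfin
  rw [one_div, Real.rpow_inv_le_iff_of_pos (by positivity) zero_le_one hp0, Real.one_rpow] at hfin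
  exact hfin

open Pointwise in
theorem isNearlyUniformlyConvex (Λ : VPSequence) (p : ℝ) [hp : Fact (1 < p)] :
    IsNearlyUniformlyConvex (Λ.V p) := by
  have hp0 : 0 < p := one_pos.trans hp.out
  refine ⟨(isReflexiveSpace Λ p).completeSpace, fun ε hε => ?_⟩
  -- The cap at 1 keeps `1 - c` nonnegative when `ε > 2`.
  set c : ℝ := min ((ε / 2) ^ p) 1 with hc
  have hc0 : 0 < c := lt_min (by positivity) one_pos
  have hc1 : c ≤ 1 := min_le_right _ _
  set r : ℝ := (1 - c) ^ (1 / p) with hr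
  have hr0 : 0 ≤ r := Real.rpow_nonneg (by linarith) _
  have hr1 : r < 1 := Real.rpow_lt_one (by linarith) (by linarith) (one_div_pos.2 hp0)
  -- `‖y‖ ≤ r` and `‖z‖ < (1 - r) / 2` will give `‖y + z‖ < 1 - (1 - r) / 2`.
  refine ⟨(1 - r) / 2, by linarith, by linarith, fun x hx hsep => ?_⟩
  have hx1 : ∀ n, ‖x n‖ ≤ 1 := fun n => mem_closedBall_zero_iff.1 (hx n)
  obtain ⟨y, hy1, s, hs, hy⟩ := exists_subseq_tendsto hx1
  have hyp := norm_rpow_add_le_one hε (fun n => hx1 (s n))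
    (fun n m hnm => lt_norm_sub_of_lt_sep hsep (hs.injective.ne hnm)) hy
  have hyr : ‖y‖ ≤ r := by
    rw [hr, one_div, Real.le_rpow_inv_iff_of_pos (norm_nonneg _) (by linarith) hp0]
    linarith [min_le_left ((ε / 2) ^ p) 1]
  obtain ⟨z, hz, hzlt⟩ := exists_mem_convexHull_norm_lt (y := fun n => x (s n) - y) (M := 1 + 1)
    (fun n => (norm_sub_le _ _).trans (add_le_add (hx1 _) hy1))
    (fun j => by
      have := (hy j).sub_const (y.1 j)
      rwa [sub_self] at this)
    (η := (1 - r) / 2) (by linarith)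
  refine ⟨y + z, ?_, ?_⟩
  · have hsub : (Set.range fun n => x (s n) - y) ⊆
        (fun z => y + z) ⁻¹' convexHull ℝ (Set.range x) := by
      rintro _ ⟨n, rfl⟩
      refine subset_convexHull ℝ _ ⟨s n, ?_⟩
      exact (add_sub_cancel y (x (s n))).symm
    exact convexHull_min hsub ((convex_convexHull ℝ _).translate_preimage_right y) hz
  · rw [smul_unitClosedBall_of_nonneg (by linarith), mem_closedBall_zero_iff]
    linarith [norm_add_le y z]

end VPSequence.V

theorem mainTheorem3 (Λ : VPSequence) (p : ℝ) [hp : Fact (1 < p)] :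
    IsNearlyUniformlyConvex (Λ.V p) ∧ IsReflexiveSpace (Λ.V p) :=
  ⟨VPSequence.V.isNearlyUniformlyConvex Λ p, VPSequence.V.isReflexiveSpace Λ p⟩
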